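/- There exists a $2\pi$-periodic, even, non-negative function $f:\mathbb{R}\to\mathbb{R}$, integrable on $[-\pi,\pi]$, whose Fourier series diverges unboundedly almost everywhere. That is, writing $\hat f(l)=\frac{1}{2\pi}\int_{-\pi}^{\pi}f(\theta)e^{-\mathrm{i}l\theta}\,d\theta$ and $S_n(f,\theta)=\sum_{l=-n}^{n}\hat f(l)e^{\mathrm{i}l\theta}$ (which is real, since $f$ is real-valued and even), for Lebesgue-almost every $\theta\in\mathbb{R}$ one has $$\limsup_{n\to\infty}S_n(f,\theta)=+\infty\quad\text{and}\quad\liminf_{n\to\infty}S_n(f,\theta)=-\infty .$$ -/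

import Mathlib

open MeasureTheory Filter

/-- The Fourier coefficient `f̂(l) = (1/2π) ∫_{-π}^{π} f(θ) e^{-ilθ} dθ`. -/
noncomputable def fourierHat (f : ℝ → ℂ) (l : ℤ) : ℂ :=
  fourierCoeffOn (neg_lt_self Real.pi_pos) f l

theorem fourierHat_eq (f : ℝ → ℂ) (l : ℤ) :
    fourierHat f l = (1 / (2 * (Real.pi : ℂ))) *
      ∫ θ in (-Real.pi)..Real.pi, f θ * Complex.exp (-(Complex.I * l * θ)) := by
  rw [fourierHat, fourierCoeffOn_eq_integral, Complex.real_smul]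
  congr 1
  · push_cast
    congr 1
    ring
  · refine intervalIntegral.integral_congr fun θ _ => ?_
    have hpi : (Real.pi : ℂ) ≠ 0 := by exact_mod_cast Real.pi_ne_zero
    simp only [fourier_coe_apply, smul_eq_mul]
    rw [mul_comm]
    congr 2
    push_cast
    have h2 : (Real.pi : ℂ) - -(Real.pi : ℂ) = 2 * Real.pi := by ring
    rw [h2]
    field_simp

/-- The `n`-th symmetric partial Fourier sum `S_n(f, θ) = ∑_{l=-n}^{n} f̂(l) e^{ilθ}`. -/
noncomputable def symmPartialFourierSum (f : ℝ → ℂ) (n : ℕ) (θ : ℝ) : ℂ :=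
  ∑ l ∈ Finset.Icc (-(n : ℤ)) (n : ℤ), fourierHat f l * Complex.exp (Complex.I * l * θ)

/-- The Fourier series of `f` diverges unboundedly at `θ`: the symmetric partial sums at `θ` are
real numbers with limit superior `+∞` and limit inferior `-∞`. -/
def FourierSeriesDivergesUnboundedlyAt (f : ℝ → ℂ) (θ : ℝ) : Prop :=
  (∀ n : ℕ, (symmPartialFourierSum f n θ).im = 0) ∧
  limsup (fun n : ℕ => ((symmPartialFourierSum f n θ).re : EReal)) atTop = ⊤ ∧
  liminf (fun n : ℕ => ((symmPartialFourierSum f n θ).re : EReal)) atTop = ⊥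

/-! This is Kolmogorov's construction. Put equal point masses at `± a_j`, `j < n`, with the `a_j`
about `π / n` apart in `(0, π)`. Their partial sums at `x` average the kernels `sin ((k + 1/2) u) /
sin (u / 2)` over `u = x ∓ a_j`. If the `a_j` and `2π` are rationally independent, then for almost
every `x` the phases at the points `x - a_j` can be steered independently by choosing `k`. Instead
of Kronecker's theorem, the `k` are averaged against a Riesz product: a nonnegative weight of Cesàro
mean one that correlates with each `sin ((k + 1/2) (x - a_j))` with a prescribed sign and is
orthogonal to the terms at `x + a_j`. The weighted mean of the partial sums is `± (1/4n) ∑ 1 / |sin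
((x - a_j) / 2)|`, whose modulus is at least a multiple of a harmonic sum, so some partial sums are
very large and others very negative (`GenericFor.le_of_cosSum_le`, `exists_pointMass`).

A Fejér mean of high order turns the measure into a nonnegative polynomial of mean one, changing the
relevant partial sums by at most one (`exists_trigPoly`). Such polynomials are added with weights
`2^{-J} / (2 L_J + 1)`, where `L_J` bounds the degrees of all earlier blocks. Up to the degree of
block `J` the other blocks contribute boundedly in terms of `L_J` (`abs_cosSum_series_sub_le`),
while block `J` was chosen to beat that bound by `J` off a set of measure at most `2^{-J}`;
Borel–Cantelli finishes. -/

open scoped Topology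

/-! ### Cosine sums and the Dirichlet kernel -/

/-- The symmetric cosine sum `∑_{|l| ≤ k} c_{|l|} cos (l x)`. -/
noncomputable def cosSum (c : ℕ → ℝ) (k : ℕ) (x : ℝ) : ℝ :=
  ∑ l ∈ Finset.Icc (-(k : ℤ)) k, c l.natAbs * Real.cos (l * x)

theorem cosSum_zero (c : ℕ → ℝ) (x : ℝ) : cosSum c 0 x = c 0 := by
  simp [cosSum]

theorem cosSum_succ (c : ℕ → ℝ) (k : ℕ) (x : ℝ) :
    cosSum c (k + 1) x = cosSum c k x + 2 * c (k + 1) * Real.cos ((k + 1) * x) := by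
  have h1 : ((k : ℤ) + 1).natAbs = k + 1 := by omega
  have h2 : (-((k : ℤ) + 1)).natAbs = k + 1 := by omega
  unfold cosSum
  rw [Nat.cast_add, Nat.cast_one, Finset.sum_Icc_succ_eq_add_endpoints, h1, h2]
  have h3 : ((-((k : ℤ) + 1) : ℤ) : ℝ) * x = -((k + 1) * x) := by push_cast; ring
  rw [h3, Real.cos_neg]
  push_cast
  ring

theorem abs_cosSum_le {c : ℕ → ℝ} {B : ℝ} (k : ℕ) (hc : ∀ l ≤ k, |c l| ≤ B) (x : ℝ) :
    |cosSum c k x| ≤ B * (2 * k + 1) := by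
  induction k with
  | zero => simpa [cosSum_zero] using hc 0
  | succ k ih =>
    rw [cosSum_succ]
    have h : |2 * c (k + 1) * Real.cos ((k + 1) * x)| ≤ 2 * B := by
      rw [abs_mul, abs_mul, abs_two]
      nlinarith [hc (k + 1) le_rfl, Real.abs_cos_le_one ((k + 1) * x), abs_nonneg (c (k + 1)),
        abs_nonneg (Real.cos ((k + 1) * x))]
    push_cast
    linarith [abs_add_le (cosSum c k x) (2 * c (k + 1) * Real.cos ((k + 1) * x)),
      ih fun l hl => hc l (by omega)]

theorem cosSum_congr {c d : ℕ → ℝ} {k : ℕ} (h : ∀ l ≤ k, c l = d l) (x : ℝ) :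
    cosSum c k x = cosSum d k x := by
  refine Finset.sum_congr rfl fun l hl => ?_
  rw [Finset.mem_Icc] at hl
  rw [h _ (by omega)]

theorem cosSum_add (c d : ℕ → ℝ) (k : ℕ) (x : ℝ) :
    cosSum (fun l => c l + d l) k x = cosSum c k x + cosSum d k x := by
  simp only [cosSum, add_mul, Finset.sum_add_distrib]

theorem cosSum_sub (c d : ℕ → ℝ) (k : ℕ) (x : ℝ) :
    cosSum (fun l => c l - d l) k x = cosSum c k x - cosSum d k x := by
  simp only [cosSum, sub_mul, Finset.sum_sub_distrib]

theorem cosSum_div (c : ℕ → ℝ) (r : ℝ) (k : ℕ) (x : ℝ) :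
    cosSum (fun l => c l / r) k x = cosSum c k x / r := by
  simp only [cosSum, Finset.sum_div, div_mul_eq_mul_div]

theorem cosSum_eq_of_le {c : ℕ → ℝ} {N k : ℕ} (hc : ∀ l, N < l → c l = 0) (hk : N ≤ k) (x : ℝ) :
    cosSum c k x = cosSum c N x := by
  induction k, hk using Nat.le_induction with
  | base => rfl
  | succ k hk ih => rw [cosSum_succ, ih, hc (k + 1) (by omega)]; ring

theorem continuous_cosSum (c : ℕ → ℝ) (k : ℕ) : Continuous (cosSum c k) := by
  unfold cosSum
  fun_prop

theorem cosSum_neg (c : ℕ → ℝ) (k : ℕ) (x : ℝ) : cosSum c k (-x) = cosSum c k x := by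
  simp [cosSum]

theorem cosSum_add_int_mul_two_pi (c : ℕ → ℝ) (k : ℕ) (x : ℝ) (m : ℤ) :
    cosSum c k (x + m * (2 * Real.pi)) = cosSum c k x := by
  unfold cosSum
  refine Finset.sum_congr rfl fun l _ => ?_
  rw [show (l : ℝ) * (x + m * (2 * Real.pi)) = l * x + ((l * m : ℤ) : ℝ) * (2 * Real.pi) by
    push_cast; ring, Real.cos_add_int_mul_two_pi]

/-- The Dirichlet kernel. -/
noncomputable def dirichletKernel (k : ℕ) (t : ℝ) : ℝ := cosSum (fun _ => 1) k t

theorem dirichletKernel_mul_sin (k : ℕ) (t : ℝ) :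
    dirichletKernel k t * Real.sin (t / 2) = Real.sin ((k + 1 / 2) * t) := by
  induction k with
  | zero => simp only [dirichletKernel, cosSum_zero]; push_cast; ring_nf
  | succ k ih =>
    have h : Real.sin (((k + 1 : ℕ) + 1 / 2) * t) - Real.sin ((k + 1 / 2) * t)
        = 2 * Real.sin (t / 2) * Real.cos ((k + 1) * t) := by
      rw [Real.sin_sub_sin]
      push_cast
      ring_nf
    unfold dirichletKernel at ih ⊢
    rw [cosSum_succ]
    linarith

/-- The right side is `|∑_{k<m} e^{ikt}|²`: adding `e^{imt}` raises the squared modulus by `1 + 2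
∑_{k<m} cos ((m - k) t)`, which is the next Dirichlet kernel. This gives positivity of Fejér sums.
-/
theorem sum_dirichletKernel (m : ℕ) (t : ℝ) :
    ∑ k ∈ Finset.range m, dirichletKernel k t =
      (∑ k ∈ Finset.range m, Real.cos (k * t)) ^ 2 +
        (∑ k ∈ Finset.range m, Real.sin (k * t)) ^ 2 := by
  have key : ∀ m : ℕ, dirichletKernel m t =
      1 + 2 * ∑ k ∈ Finset.range m, Real.cos ((m - k : ℝ) * t) := by
    intro m
    induction m with
    | zero => simp [dirichletKernel, cosSum_zero]
    | succ m ih =>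
      unfold dirichletKernel at ih ⊢
      rw [cosSum_succ, ih, Finset.sum_range_succ']
      push_cast
      simp only [add_sub_add_right_eq_sub, sub_zero]
      ring
  induction m with
  | zero => simp
  | succ m ih =>
    rw [Finset.sum_range_succ, Finset.sum_range_succ, Finset.sum_range_succ, ih, key]
    have h : ∑ k ∈ Finset.range m, Real.cos ((m - k : ℝ) * t) =
        Real.cos (m * t) * ∑ k ∈ Finset.range m, Real.cos (k * t) +
          Real.sin (m * t) * ∑ k ∈ Finset.range m, Real.sin (k * t) := by
      rw [Finset.mul_sum, Finset.mul_sum, ← Finset.sum_add_distrib]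
      refine Finset.sum_congr rfl fun k _ => ?_
      rw [sub_mul, Real.cos_sub]
    rw [h]
    nlinarith [Real.sin_sq_add_cos_sq (m * t)]

theorem sum_dirichletKernel_nonneg (m : ℕ) (t : ℝ) :
    0 ≤ ∑ k ∈ Finset.range m, dirichletKernel k t := by
  rw [sum_dirichletKernel]
  positivity

/-! ### Cesàro means -/

/-- `g` has Cesàro mean `c`. -/
def HasCesaroMean (g : ℕ → ℝ) (c : ℝ) : Prop :=
  Tendsto (fun K : ℕ => (∑ k ∈ Finset.range K, g k) / K) atTop (𝓝 c)

namespace HasCesaroMean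

theorem add {g h : ℕ → ℝ} {c d : ℝ} (hg : HasCesaroMean g c) (hh : HasCesaroMean h d) :
    HasCesaroMean (fun k => g k + h k) (c + d) := by
  refine (Tendsto.add hg hh).congr fun K => ?_
  rw [Finset.sum_add_distrib, add_div]

theorem const_mul {g : ℕ → ℝ} {c : ℝ} (a : ℝ) (hg : HasCesaroMean g c) :
    HasCesaroMean (fun k => a * g k) (a * c) := by
  refine (Tendsto.const_mul a hg).congr fun K => ?_
  rw [← Finset.mul_sum, mul_div_assoc]

theorem congr {g h : ℕ → ℝ} {c d : ℝ} (hg : HasCesaroMean g c) (e : ∀ k, h k = g k)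
    (hcd : d = c) : HasCesaroMean h d := by
  rw [show h = g from funext e, hcd]
  exact hg

theorem sum {ι : Type*} {g : ι → ℕ → ℝ} {c : ι → ℝ} (s : Finset ι)
    (hg : ∀ i ∈ s, HasCesaroMean (g i) (c i)) :
    HasCesaroMean (fun k => ∑ i ∈ s, g i k) (∑ i ∈ s, c i) := by
  refine (tendsto_finsetSum s hg).congr fun K => ?_
  rw [← Finset.sum_div, Finset.sum_comm]

theorem le {g h : ℕ → ℝ} {c d : ℝ} (hg : HasCesaroMean g c) (hh : HasCesaroMean h d)
    (e : ∀ k, g k ≤ h k) : c ≤ d := by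
  refine le_of_tendsto_of_tendsto' hg hh fun K => ?_
  gcongr with k
  exact e k

theorem one : HasCesaroMean (fun _ => 1) 1 := by
  refine tendsto_const_nhds.congr' ?_
  filter_upwards [eventually_gt_atTop 0] with K hK
  have : (K : ℝ) ≠ 0 := by positivity
  simp [this]

/-- A cosine of nontrivial frequency averages to zero. -/
theorem cos {t : ℝ} (ht : ∀ m : ℤ, t ≠ m * (2 * Real.pi)) (c : ℝ) :
    HasCesaroMean (fun k => Real.cos (k * t + c)) 0 := by
  have hs : Real.sin (t / 2) ≠ 0 := by
    intro h
    obtain ⟨m, hm⟩ := Real.sin_eq_zero_iff.1 h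
    exact ht m (by linarith)
  have tele : ∀ K : ℕ, 2 * Real.sin (t / 2) * ∑ k ∈ Finset.range K, Real.cos (k * t + c) =
      Real.sin ((K - 1 / 2) * t + c) - Real.sin (-t / 2 + c) := by
    intro K
    induction K with
    | zero => simp; ring_nf
    | succ K ih =>
      rw [Finset.sum_range_succ, mul_add, ih]
      have := Real.sin_sub_sin (((K + 1 : ℕ) - 1 / 2) * t + c) ((K - 1 / 2) * t + c)
      rw [show ((((K + 1 : ℕ) : ℝ) - 1 / 2) * t + c - ((K - 1 / 2) * t + c)) / 2 = t / 2 by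
          push_cast; ring,
        show ((((K + 1 : ℕ) : ℝ) - 1 / 2) * t + c + ((K - 1 / 2) * t + c)) / 2 = K * t + c by
          push_cast; ring] at this
      linarith
  have hb : ∀ K : ℕ, |∑ k ∈ Finset.range K, Real.cos (k * t + c)| ≤ 1 / |Real.sin (t / 2)| := by
    intro K
    rw [le_div_iff₀ (abs_pos.2 hs), ← abs_mul]
    have h1 := tele K
    have h2 := Real.abs_sin_le_one ((K - 1 / 2) * t + c)
    have h3 := Real.abs_sin_le_one (-t / 2 + c)
    rw [abs_le] at h2 h3 ⊢
    constructor <;> linarith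
  refine squeeze_zero_norm (fun K => ?_)
    (tendsto_const_div_atTop_nhds_zero_nat (1 / |Real.sin (t / 2)|))
  rw [norm_div, Real.norm_eq_abs, Real.norm_natCast]
  gcongr
  exact hb K

end HasCesaroMean

/-! ### Riesz products -/

/-- The Riesz product `∏_{j ∈ J} (1 + ε_j sin ((k + 1/2) y_j))`. -/
noncomputable def rieszProd {ι : Type*} (ε y : ι → ℝ) (J : Finset ι) (k : ℕ) : ℝ :=
  ∏ j ∈ J, (1 + ε j * Real.sin ((k + 1 / 2) * y j))

theorem rieszProd_nonneg {ι : Type*} {ε : ι → ℝ} (hε : ∀ j, |ε j| ≤ 1) (y : ι → ℝ) (J : Finset ι) (k : ℕ) :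
    0 ≤ rieszProd ε y J k := by
  refine Finset.prod_nonneg fun j _ => ?_
  have h : |ε j * Real.sin ((k + 1 / 2) * y j)| ≤ 1 := by
    rw [abs_mul]
    exact mul_le_one₀ (hε j) (abs_nonneg _) (Real.abs_sin_le_one _)
  linarith [(abs_le.1 h).1]

section Riesz

variable {ι : Type*} [DecidableEq ι]

/-- Each factor splits a cosine of frequency `t` into cosines of frequencies `t` and `t ± y j`, so
no resulting frequency is a multiple of `2π`. The phase `c` is arbitrary because the half-integer
shift changes it at each step of the induction. -/
theorem hasCesaroMean_rieszProd_mul_cos (ε y : ι → ℝ) (J : Finset ι) :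
    ∀ t : ℝ, (∀ (s : ι → ℤ) (m : ℤ), t + ∑ j ∈ J, s j * y j ≠ m * (2 * Real.pi)) →
      ∀ c : ℝ, HasCesaroMean (fun k => rieszProd ε y J k * Real.cos (k * t + c)) 0 := by
  induction J using Finset.induction_on with
  | empty =>
    intro t ht c
    refine (HasCesaroMean.cos (t := t) (fun m => ?_) c).congr (fun k => ?_) rfl
    · simpa using ht 0 m
    · simp [rieszProd]
  | insert j J hj ih =>
    intro t ht c
    have shift : ∀ (r : ℤ) (s : ι → ℤ) (m : ℤ),
        t + r * y j + ∑ i ∈ J, s i * y i ≠ m * (2 * Real.pi) := by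
      intro r s m
      have := ht (Function.update s j r) m
      rw [Finset.sum_insert hj, Function.update_self] at this
      rw [add_assoc]
      convert this using 4 with i hi
      rw [Function.update_of_ne (ne_of_mem_of_not_mem hi hj)]
    have h0 := ih t (fun s m => by simpa using shift 0 s m) c
    have h1 := ih (t + y j) (fun s m => by simpa using shift 1 s m) (c + y j / 2 - Real.pi / 2)
    have h2 := ih (t - y j) (fun s m => by simpa [sub_eq_add_neg] using shift (-1) s m)
      (c - y j / 2 + Real.pi / 2)
    refine (h0.add ((h1.add h2).const_mul (ε j / 2))).congr (fun k => ?_) (by ring)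
    rw [rieszProd, Finset.prod_insert hj, ← rieszProd]
    have e : 2 * Real.sin ((k + 1 / 2) * y j) * Real.cos (k * t + c) =
        Real.cos (k * (t + y j) + (c + y j / 2 - Real.pi / 2)) +
          Real.cos (k * (t - y j) + (c - y j / 2 + Real.pi / 2)) := by
      rw [Real.cos_add_cos, ← Real.cos_sub_pi_div_two ((k + 1 / 2) * y j)]
      ring_nf
    linear_combination (ε j / 2 * rieszProd ε y J k) * e

theorem hasCesaroMean_rieszProd_mul_sin (ε y : ι → ℝ) (J : Finset ι) {t : ℝ}
    (ht : ∀ (s : ι → ℤ) (m : ℤ), t + ∑ j ∈ J, s j * y j ≠ m * (2 * Real.pi)) :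
    HasCesaroMean (fun k => rieszProd ε y J k * Real.sin ((k + 1 / 2) * t)) 0 := by
  refine (hasCesaroMean_rieszProd_mul_cos ε y J t ht (t / 2 - Real.pi / 2)).congr
    (fun k => ?_) rfl
  rw [← Real.cos_sub_pi_div_two]
  ring_nf

/-- No nontrivial integer combination of the `y_j`, `j ∈ J`, is a multiple of `2π`. -/
def IndepModTwoPi (y : ι → ℝ) (J : Finset ι) : Prop :=
  ∀ (s : ι → ℤ) (m : ℤ), (∃ j ∈ J, s j ≠ 0) → ∑ j ∈ J, s j * y j ≠ m * (2 * Real.pi)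

theorem IndepModTwoPi.insert_ne {y : ι → ℝ} {j : ι} {J : Finset ι} (hj : j ∉ J)
    (h : IndepModTwoPi y (insert j J)) {r : ℤ} (hr : r ≠ 0) (s : ι → ℤ) (m : ℤ) :
    r * y j + ∑ i ∈ J, s i * y i ≠ m * (2 * Real.pi) := by
  have := h (Function.update s j r) m ⟨j, by simp, by simpa using hr⟩
  rw [Finset.sum_insert hj, Function.update_self] at this
  convert this using 4 with i hi
  rw [Function.update_of_ne (ne_of_mem_of_not_mem hi hj)]

theorem IndepModTwoPi.of_insert {y : ι → ℝ} {j : ι} {J : Finset ι} (hj : j ∉ J)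
    (h : IndepModTwoPi y (insert j J)) : IndepModTwoPi y J := by
  rintro s m ⟨i, hi, hsi⟩
  have := h (Function.update s j 0) m
    ⟨i, by simp [hi], by rwa [Function.update_of_ne (ne_of_mem_of_not_mem hi hj)]⟩
  rw [Finset.sum_insert hj, Function.update_self, Int.cast_zero, zero_mul, zero_add] at this
  convert this using 4 with i hi
  rw [Function.update_of_ne (ne_of_mem_of_not_mem hi hj)]

theorem hasCesaroMean_rieszProd (ε y : ι → ℝ) (J : Finset ι) (h : IndepModTwoPi y J) :
    HasCesaroMean (rieszProd ε y J) 1 := by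
  induction J using Finset.induction_on with
  | empty => exact HasCesaroMean.one.congr (fun k => by simp [rieszProd]) rfl
  | insert j J hj ih =>
    have h1 := hasCesaroMean_rieszProd_mul_sin ε y J (t := y j)
      (fun s m => by simpa using h.insert_ne hj one_ne_zero s m)
    refine ((ih (h.of_insert hj)).add (h1.const_mul (ε j))).congr (fun k => ?_) (by ring)
    rw [rieszProd, Finset.prod_insert hj, ← rieszProd]
    ring

/-- Only the factor of index `j` resonates: it produces `ε j * sin²`, of mean `ε j / 2`. -/
theorem hasCesaroMean_rieszProd_mul_sin_self (ε y : ι → ℝ) {J : Finset ι} (h : IndepModTwoPi y J)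
    {j : ι} (hj : j ∈ J) :
    HasCesaroMean (fun k => rieszProd ε y J k * Real.sin ((k + 1 / 2) * y j)) (ε j / 2) := by
  obtain ⟨J, hj', rfl⟩ : ∃ J', j ∉ J' ∧ insert j J' = J :=
    ⟨J.erase j, by simp, Finset.insert_erase hj⟩
  have h1 := hasCesaroMean_rieszProd_mul_sin ε y J (t := y j)
    (fun s m => by simpa using h.insert_ne hj' one_ne_zero s m)
  have h2 := hasCesaroMean_rieszProd_mul_cos ε y J (2 * y j)
    (fun s m => by simpa using h.insert_ne hj' two_ne_zero s m) (y j)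
  have h0 := hasCesaroMean_rieszProd ε y J (h.of_insert hj')
  refine (h1.add ((h0.add (h2.const_mul (-1))).const_mul (ε j / 2))).congr (fun k => ?_) (by ring)
  rw [rieszProd, Finset.prod_insert hj', ← rieszProd]
  have e : Real.cos (k * (2 * y j) + y j) = 1 - 2 * Real.sin ((k + 1 / 2) * y j) ^ 2 := by
    rw [Real.sin_sq_eq_half_sub]
    ring_nf
  rw [e]
  ring

end Riesz

/-! ### Averages of point masses at rationally independent points -/

/-- The Fourier coefficients of the average of the point masses at `± a_j`, `j < n`. -/
noncomputable def pointMassCoeff (n : ℕ) (a : ℕ → ℝ) (l : ℕ) : ℝ :=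
  (∑ j ∈ Finset.range n, Real.cos (l * a j)) / n

theorem abs_pointMassCoeff_le (n : ℕ) (a : ℕ → ℝ) (l : ℕ) : |pointMassCoeff n a l| ≤ 1 := by
  rw [pointMassCoeff, abs_div, Nat.abs_cast]
  refine div_le_one_of_le₀ ((Finset.abs_sum_le_sum_abs _ _).trans ?_) (by positivity)
  refine (Finset.sum_le_sum fun j _ => Real.abs_cos_le_one (l * a j)).trans ?_
  simp

theorem cosSum_pointMassCoeff (n : ℕ) (a : ℕ → ℝ) (k : ℕ) (x : ℝ) :
    cosSum (pointMassCoeff n a) k x =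
      (∑ j ∈ Finset.range n, (dirichletKernel k (x - a j) + dirichletKernel k (x + a j))) /
        (2 * n) := by
  have h : ∀ j, dirichletKernel k (x - a j) + dirichletKernel k (x + a j) =
      2 * cosSum (fun l => Real.cos (l * a j)) k x := by
    intro j
    simp only [dirichletKernel, cosSum]
    rw [← Finset.sum_add_distrib, Finset.mul_sum]
    refine Finset.sum_congr rfl fun l _ => ?_
    have e : Real.cos (l.natAbs * a j) = Real.cos (l * a j) := by
      rw [Nat.cast_natAbs, Int.cast_abs]
      rcases abs_choice (l : ℝ) with h | h <;> simp [h]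
    rw [e, mul_sub, mul_add, Real.cos_sub, Real.cos_add]
    ring
  simp only [h, ← Finset.mul_sum]
  rw [mul_div_mul_left _ _ two_ne_zero]
  unfold cosSum pointMassCoeff
  rw [Finset.sum_comm, Finset.sum_div]
  refine Finset.sum_congr rfl fun l _ => ?_
  rw [Finset.sum_div, Finset.sum_div, Finset.sum_mul]
  exact Finset.sum_congr rfl fun j _ => by ring

/-- No nontrivial integer combination of `x` and the `a_j`, `j < n`, is a multiple of `2π`. -/
def GenericFor (n : ℕ) (a : ℕ → ℝ) (x : ℝ) : Prop :=
  ∀ (q : ℤ) (s : ℕ → ℤ) (m : ℤ), (q ≠ 0 ∨ ∃ j ∈ Finset.range n, s j ≠ 0) →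
    q * x + ∑ j ∈ Finset.range n, s j * a j ≠ m * (2 * Real.pi)

namespace GenericFor

variable {n : ℕ} {a : ℕ → ℝ} {x : ℝ}

theorem indep (h : GenericFor n a x) :
    IndepModTwoPi (fun j => x - a j) (Finset.range n) := by
  rintro s m ⟨j, hj, hs⟩
  have := h (∑ i ∈ Finset.range n, s i) (fun i => -s i) m (Or.inr ⟨j, hj, by simpa using hs⟩)
  convert this using 1
  simp only [mul_sub, Finset.sum_sub_distrib, Int.cast_sum, Finset.sum_mul, Int.cast_neg,
    neg_mul, Finset.sum_neg_distrib]
  ring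

/-- The reflected masses do not resonate. If every `a_j` cancels, then `s` is the indicator of `i`
and the coefficient of `x` is `2`, not `0`. -/
theorem add_ne (h : GenericFor n a x) {i : ℕ} (hi : i ∈ Finset.range n) (s : ℕ → ℤ) (m : ℤ) :
    x + a i + ∑ j ∈ Finset.range n, s j * (x - a j) ≠ m * (2 * Real.pi) := by
  have := h (1 + ∑ j ∈ Finset.range n, s j) (fun j => (if j = i then 1 else 0) - s j) m (by
    by_contra! hc
    obtain ⟨h1, h2⟩ := hc
    have : ∑ j ∈ Finset.range n, s j = ∑ j ∈ Finset.range n, if j = i then 1 else 0 :=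
      Finset.sum_congr rfl fun j hj => by linarith [h2 j hj]
    rw [Finset.sum_ite_eq' (Finset.range n) i (fun _ => (1 : ℤ)), if_pos hi] at this
    omega)
  convert this using 1
  have e : ∑ j ∈ Finset.range n, (if j = i then (1 : ℝ) else 0) * a j = a i := by
    simp only [ite_mul, one_mul, zero_mul, Finset.sum_ite_eq', if_pos hi]
  push_cast
  simp only [mul_sub, sub_mul, Finset.sum_sub_distrib, Finset.sum_mul, add_mul, one_mul, e]
  ring

theorem sin_sub_ne_zero (h : GenericFor n a x) {i : ℕ} (hi : i ∈ Finset.range n) :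
    Real.sin ((x - a i) / 2) ≠ 0 := by
  intro h0
  obtain ⟨m, hm⟩ := Real.sin_eq_zero_iff.1 h0
  refine h.indep (fun j => if j = i then 1 else 0) m ⟨i, hi, by simp⟩ ?_
  push_cast
  simp only [ite_mul, one_mul, zero_mul, Finset.sum_ite_eq', if_pos hi]
  linarith

theorem sin_add_ne_zero (h : GenericFor n a x) {i : ℕ} (hi : i ∈ Finset.range n) :
    Real.sin ((x + a i) / 2) ≠ 0 := by
  intro h0
  obtain ⟨m, hm⟩ := Real.sin_eq_zero_iff.1 h0
  refine h.add_ne hi 0 m ?_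
  simp
  linarith

theorem hasCesaroMean (h : GenericFor n a x) (ε : ℕ → ℝ) :
    HasCesaroMean (fun k => rieszProd ε (fun j => x - a j) (Finset.range n) k *
        cosSum (pointMassCoeff n a) k x)
      ((∑ j ∈ Finset.range n, ε j / 2 / Real.sin ((x - a j) / 2)) / (2 * n)) := by
  have key : ∀ j ∈ Finset.range n,
      HasCesaroMean (fun k => rieszProd ε (fun j => x - a j) (Finset.range n) k *
        (dirichletKernel k (x - a j) + dirichletKernel k (x + a j)))
        (ε j / 2 / Real.sin ((x - a j) / 2)) := by
    intro j hj
    have h1 := hasCesaroMean_rieszProd_mul_sin_self ε (fun j => x - a j) h.indep hj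
    have h2 := hasCesaroMean_rieszProd_mul_sin ε (fun j => x - a j) _ (h.add_ne hj)
    refine ((h1.const_mul (1 / Real.sin ((x - a j) / 2))).add
      (h2.const_mul (1 / Real.sin ((x + a j) / 2)))).congr (fun k => ?_) (by ring)
    rw [← dirichletKernel_mul_sin, ← dirichletKernel_mul_sin]
    have := h.sin_sub_ne_zero hj
    have := h.sin_add_ne_zero hj
    field_simp
  refine ((HasCesaroMean.sum _ key).const_mul (1 / (2 * n : ℝ))).congr (fun k => ?_) (by ring)
  rw [cosSum_pointMassCoeff, ← Finset.mul_sum]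
  ring

/-- The Riesz weight with `ε_j = σ * sign (sin ((x - a_j) / 2))` makes all terms of the weighted
mean add up without cancellation. Taking `σ = 1` and `σ = -1` treats large positive and large
negative partial sums together. -/
theorem le_of_cosSum_le (h : GenericFor n a x) {σ M : ℝ} (hσ : |σ| ≤ 1)
    (hM : ∀ k, σ * cosSum (pointMassCoeff n a) k x ≤ M) :
    σ ^ 2 * ((∑ j ∈ Finset.range n, 1 / |Real.sin ((x - a j) / 2)|) / (4 * n)) ≤ M := by
  have hε : ∀ j, |σ * SignType.sign (Real.sin ((x - a j) / 2))| ≤ 1 := by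
    intro j
    rw [abs_mul]
    refine mul_le_one₀ hσ (abs_nonneg _) ?_
    rcases lt_trichotomy (Real.sin ((x - a j) / 2)) 0 with h | h | h <;> simp [h]
  have h1 := (h.hasCesaroMean
    (fun j => σ * SignType.sign (Real.sin ((x - a j) / 2)))).const_mul σ
  have h2 := (hasCesaroMean_rieszProd (fun j => σ * SignType.sign (Real.sin ((x - a j) / 2)))
    (fun j => x - a j) _ h.indep).const_mul M
  have := h1.le h2 fun k => by
    have h0 := rieszProd_nonneg hε (fun j => x - a j) (Finset.range n) k
    have := mul_le_mul_of_nonneg_right (hM k) h0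
    linarith
  rw [mul_one] at this
  refine le_trans (le_of_eq ?_) this
  have e : ∀ j ∈ Finset.range n, σ * SignType.sign (Real.sin ((x - a j) / 2)) / 2 /
      Real.sin ((x - a j) / 2) = σ / 2 * (1 / |Real.sin ((x - a j) / 2)|) := by
    intro j hj
    have h0 := h.sin_sub_ne_zero hj
    rcases lt_or_gt_of_ne h0 with h | h
    · rw [sign_neg h, abs_of_neg h, SignType.coe_neg_one]; field_simp
    · rw [sign_pos h, abs_of_pos h, SignType.coe_one]; field_simp
  rw [Finset.sum_congr rfl e, ← Finset.mul_sum]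
  ring

end GenericFor

/-! ### Nearly equidistant independent points and the harmonic lower bound -/

theorem exists_transcendental_mem_Ioo : ∃ θ ∈ Set.Ioo (0 : ℝ) 1, Transcendental ℤ θ := by
  by_contra! h
  have hc : (Set.Ioo (0 : ℝ) 1).Countable :=
    (Algebraic.countable ℤ ℝ).mono fun θ hθ => not_not.1 (h θ hθ)
  have := hc.measure_zero volume
  simp at this

/-- The points `π (j + θ ^ (j + 1)) / n`. -/
noncomputable def perturbedPoint (θ : ℝ) (n j : ℕ) : ℝ := Real.pi * (j + θ ^ (j + 1)) / n

/-- After cancelling `π`, a relation is an integer polynomial vanishing at `θ`. The exponent `j + 1`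
keeps each `s j` apart from the constant term, which absorbs `2mn` and the `s j * j`. -/
theorem sum_perturbedPoint_ne {θ : ℝ} (hθ : Transcendental ℤ θ) (n : ℕ) (s : ℕ → ℤ) (m : ℤ)
    (hs : ∃ j ∈ Finset.range n, s j ≠ 0) :
    ∑ j ∈ Finset.range n, s j * perturbedPoint θ n j ≠ m * (2 * Real.pi) := by
  intro h
  obtain ⟨i, hi, hsi⟩ := hs
  have hn : (n : ℝ) ≠ 0 := by
    have := Finset.mem_range.1 hi
    exact Nat.cast_ne_zero.2 (by omega)
  have h' : ∑ j ∈ Finset.range n, (s j : ℝ) * (j + θ ^ (j + 1)) = 2 * m * n := by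
    have e : ∑ j ∈ Finset.range n, s j * perturbedPoint θ n j =
        Real.pi / n * ∑ j ∈ Finset.range n, (s j : ℝ) * (j + θ ^ (j + 1)) := by
      rw [Finset.mul_sum]
      exact Finset.sum_congr rfl fun j _ => by rw [perturbedPoint]; ring
    rw [e] at h
    have := Real.pi_ne_zero
    field_simp at h
    linarith
  obtain ⟨r, hr⟩ : ∃ r : ℤ, (r : ℝ) = 2 * m * n := ⟨2 * m * n, by push_cast; ring⟩
  rw [← hr] at h'
  let P : Polynomial ℤ := ∑ j ∈ Finset.range n,
    Polynomial.C (s j) * (Polynomial.C (j : ℤ) + Polynomial.X ^ (j + 1)) -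
      Polynomial.C r
  have hP : Polynomial.aeval θ P = 0 := by
    simp [P, h']
  have h0 := (transcendental_iff.1 hθ) P hP
  have hcoef : P.coeff (i + 1) = s i := by
    simp [P, Polynomial.finsetSum_coeff, Polynomial.coeff_X_pow,
      Polynomial.coeff_C_succ, Finset.mem_range.1 hi, -eq_intCast]
  rw [h0] at hcoef
  exact hsi (by simpa using hcoef.symm)

theorem ae_genericFor {n : ℕ} {a : ℕ → ℝ}
    (ha : ∀ (s : ℕ → ℤ) (m : ℤ), (∃ j ∈ Finset.range n, s j ≠ 0) →
      ∑ j ∈ Finset.range n, s j * a j ≠ m * (2 * Real.pi)) :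
    ∀ᵐ x : ℝ, GenericFor n a x := by
  -- A relation with `q ≠ 0` determines `x`. Restricting `s` to `Fin n` leaves countably many
  -- relations.
  have hc : (Set.range fun p : ℤ × (Fin n → ℤ) × ℤ =>
      (p.2.2 * (2 * Real.pi) - ∑ j, p.2.1 j * a j) / p.1).Countable := Set.countable_range _
  filter_upwards [hc.ae_notMem volume] with x hx q s m hqs he
  by_cases hq : q = 0
  · subst hq
    exact ha s m (by simpa using hqs) (by simpa using he)
  · refine hx ⟨(q, fun j => s j, m), ?_⟩
    have : (q : ℝ) ≠ 0 := by exact_mod_cast hq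
    rw [Finset.sum_range] at he
    simp only
    rw [div_eq_iff this]
    linarith

/-- On at least one side of `p` there are `m` consecutive indices below `n`, starting at `p` itself.
-/
theorem harmonic_sum_le {n m p : ℕ} (hm : 2 * m ≤ n) (hp : p < n) :
    ∑ i ∈ Finset.range m, 1 / ((i : ℝ) + 1) ≤
      ∑ j ∈ Finset.range n, 1 / (|(p : ℝ) - j| + 1) := by
  rcases le_or_gt m p with h | h
  · have e : ∑ i ∈ Finset.range m, 1 / ((i : ℝ) + 1) =
        ∑ j ∈ (Finset.range m).image (fun i => p - i), 1 / (|(p : ℝ) - j| + 1) := by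
      rw [Finset.sum_image]
      · refine Finset.sum_congr rfl fun i hi => ?_
        have := Finset.mem_range.1 hi
        rw [Nat.cast_sub (by omega), sub_sub_cancel, Nat.abs_cast]
      · intro i hi j hj hij
        simp only [Finset.coe_range, Set.mem_Iio] at hi hj hij
        omega
    rw [e]
    refine Finset.sum_le_sum_of_subset_of_nonneg ?_ fun _ _ _ => by positivity
    intro j hj
    simp only [Finset.mem_image, Finset.mem_range] at hj ⊢
    omega
  · have e : ∑ i ∈ Finset.range m, 1 / ((i : ℝ) + 1) =
        ∑ j ∈ (Finset.range m).image (fun i => p + i), 1 / (|(p : ℝ) - j| + 1) := by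
      rw [Finset.sum_image]
      · refine Finset.sum_congr rfl fun i hi => ?_
        rw [Nat.cast_add, sub_add_cancel_left, abs_neg, Nat.abs_cast]
      · intro i hi j hj hij
        simp only at hij
        omega
    rw [e]
    refine Finset.sum_le_sum_of_subset_of_nonneg ?_ fun _ _ _ => by positivity
    intro j hj
    simp only [Finset.mem_image, Finset.mem_range] at hj ⊢
    omega

theorem harmonic_le_sum_inv_sin {θ : ℝ} (hθ : θ ∈ Set.Ioo (0 : ℝ) 1) {n m : ℕ} (hm : 2 * m ≤ n)
    {x : ℝ} (hx : x ∈ Set.Ioo 0 Real.pi)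
    (hsin : ∀ j ∈ Finset.range n, Real.sin ((x - perturbedPoint θ n j) / 2) ≠ 0) :
    (∑ i ∈ Finset.range m, 1 / ((i : ℝ) + 1)) / (2 * Real.pi) ≤
      (∑ j ∈ Finset.range n, 1 / |Real.sin ((x - perturbedPoint θ n j) / 2)|) / (4 * n) := by
  rcases Nat.eq_zero_or_pos n with rfl | hn
  · have : m = 0 := by omega
    simp [this]
  have hn' : (0 : ℝ) < n := by exact_mod_cast hn
  have hpi := Real.pi_pos
  set p := ⌊n * x / Real.pi⌋₊ with hpdef
  have hx0 : 0 ≤ n * x / Real.pi := by have := hx.1; positivity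
  have hp1 : (p : ℝ) ≤ n * x / Real.pi := Nat.floor_le hx0
  have hp2 : n * x / Real.pi < p + 1 := Nat.lt_floor_add_one _
  have hp : p < n := by
    have : n * x / Real.pi < n := by
      rw [div_lt_iff₀ hpi]
      exact mul_lt_mul_of_pos_left hx.2 hn'
    exact_mod_cast hp1.trans_lt this
  rw [div_le_div_iff₀ (by positivity) (by positivity)]
  have key : ∀ j ∈ Finset.range n, 1 / (|(p : ℝ) - j| + 1) * (2 * n) ≤
      1 / |Real.sin ((x - perturbedPoint θ n j) / 2)| * Real.pi := by
    intro j hj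
    have hs := abs_pos.2 (hsin j hj)
    have h1 : |Real.sin ((x - perturbedPoint θ n j) / 2)| ≤ |(x - perturbedPoint θ n j) / 2| :=
      Real.abs_sin_le_abs
    have hpow0 : 0 < θ ^ (j + 1) := pow_pos hθ.1 _
    have hpow1 : θ ^ (j + 1) ≤ 1 := pow_le_one₀ hθ.1.le hθ.2.le
    -- The fractional part of `n * x / π` and the perturbation both lie in `[0, 1]`, so they differ
    -- by at most one.
    have h2 : |n * x / Real.pi - (j + θ ^ (j + 1))| ≤ |(p : ℝ) - j| + 1 := by
      rw [abs_le]
      have := neg_abs_le ((p : ℝ) - j)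
      have := le_abs_self ((p : ℝ) - j)
      constructor <;> linarith
    have h3 : (x - perturbedPoint θ n j) / 2 =
        Real.pi / (2 * n) * (n * x / Real.pi - (j + θ ^ (j + 1))) := by
      rw [perturbedPoint]
      field_simp
    rw [h3, abs_mul, abs_of_pos (by positivity : 0 < Real.pi / (2 * n))] at h1
    rw [div_mul_eq_mul_div, div_mul_eq_mul_div, one_mul, one_mul,
      div_le_div_iff₀ (by positivity) hs]
    have h4 := h1.trans (mul_le_mul_of_nonneg_left h2 (by positivity))
    rw [h3] at hs ⊢
    rw [div_mul_eq_mul_div Real.pi _ (|(p : ℝ) - j| + 1), le_div_iff₀ (by positivity)] at h4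
    linarith
  have hsum := Finset.sum_le_sum key
  rw [← Finset.sum_mul, ← Finset.sum_mul] at hsum
  have := mul_le_mul_of_nonneg_right (harmonic_sum_le hm hp) (by positivity : (0 : ℝ) ≤ 2 * n)
  linarith

/-- Averages of point masses whose Fourier sums exceed `M` and drop below `-M` at almost every
point of `(0, π)`. -/
theorem exists_pointMass (M : ℝ) : ∃ (n : ℕ) (a : ℕ → ℝ), 0 < n ∧
    ∀ᵐ x ∂(volume.restrict (Set.Ioo 0 Real.pi)),
      (∃ k, M < cosSum (pointMassCoeff n a) k x) ∧
      (∃ k, cosSum (pointMassCoeff n a) k x < -M) := by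
  obtain ⟨θ, hθ, hT⟩ := exists_transcendental_mem_Ioo
  obtain ⟨m, hm⟩ := (Real.tendsto_sum_range_one_div_nat_succ_atTop.eventually_gt_atTop
    (M * (2 * Real.pi))).exists
  rw [← lt_div_iff₀ Real.two_pi_pos] at hm
  -- The extra point keeps `n` positive even if `m = 0`.
  refine ⟨2 * m + 1, perturbedPoint θ (2 * m + 1), by omega, ?_⟩
  filter_upwards [ae_restrict_mem measurableSet_Ioo,
    ae_restrict_of_ae (ae_genericFor (sum_perturbedPoint_ne hT (2 * m + 1)))] with x hx hg
  have hlow := hm.trans_le (harmonic_le_sum_inv_sin hθ (n := 2 * m + 1) (by omega) hx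
    fun j hj => hg.sin_sub_ne_zero hj)
  constructor
  · by_contra! h
    have := hg.le_of_cosSum_le (σ := 1) (by simp) (by simpa using h)
    rw [one_pow, one_mul] at this
    linarith
  · by_contra! h
    have := hg.le_of_cosSum_le (σ := -1) (M := M) (by simp) (fun k => by linarith [h k])
    rw [neg_one_sq, one_mul] at this
    linarith

/-! ### Fejér means -/

/-- Frequency `l` occurs in the `m - l` partial sums with `l ≤ k < m`; truncated subtraction gives
zero beyond. -/
theorem sum_cosSum (b : ℕ → ℝ) (x : ℝ) (m : ℕ) : ∀ N, m ≤ N →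
    ∑ k ∈ Finset.range m, cosSum b k x = cosSum (fun l => (m - l : ℕ) * b l) N x := by
  induction m with
  | zero => intro N _; simp [cosSum]
  | succ m ih =>
    intro N hN
    rw [Finset.sum_range_succ, ih N (by omega)]
    have h1 : cosSum b m x = cosSum (fun l => if l ≤ m then b l else 0) N x := by
      rw [cosSum_eq_of_le (N := m) (fun l hl => if_neg (by omega)) (by omega)]
      exact cosSum_congr (fun l hl => by rw [if_pos hl]) x
    rw [h1, ← cosSum_add]
    refine cosSum_congr (fun l _ => ?_) x
    split_ifs with h
    · rw [Nat.succ_sub h]; push_cast; ring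
    · rw [Nat.sub_eq_zero_of_le (by omega : m ≤ l), Nat.sub_eq_zero_of_le (by omega : m + 1 ≤ l)]
      simp

theorem exists_fejer_mean {b : ℕ → ℝ} (hb0 : b 0 = 1) (hb : ∀ l, |b l| ≤ 1)
    (hpos : ∀ m x, 0 ≤ ∑ k ∈ Finset.range m, cosSum b k x) (K L : ℕ) :
    ∃ N ≥ L, ∃ c : ℕ → ℝ, c 0 = 1 ∧ (∀ l, |c l| ≤ 1) ∧ (∀ l, N < l → c l = 0) ∧
      (∀ x, 0 ≤ cosSum c N x) ∧ K ≤ N ∧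
      ∀ k ≤ K, ∀ x, |cosSum b k x - cosSum c k x| ≤ 1 := by
  -- The multiplier `(N - l) / N` moves a coefficient with `l ≤ K` by at most `K / N`, hence a
  -- partial sum by at most `K (2K + 1) / N ≤ 1`.
  set N := K * (2 * K + 1) + K + L + 1 with hN
  have hN0 : (0 : ℝ) < N := by positivity
  refine ⟨N, by omega, fun l => (N - l : ℕ) * b l / N, ?_, ?_, ?_, ?_,
    by rw [hN]; omega, ?_⟩
  · simp only [Nat.sub_zero, hb0]
    field_simp
  · intro l
    rw [abs_div, abs_mul, Nat.abs_cast, Nat.abs_cast]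
    refine div_le_one_of_le₀ ?_ hN0.le
    have h1 : ((N - l : ℕ) : ℝ) ≤ N := by exact_mod_cast Nat.sub_le N l
    nlinarith [hb l, abs_nonneg (b l), (N - l : ℕ).cast_nonneg (α := ℝ)]
  · intro l hl
    simp only [Nat.sub_eq_zero_of_le hl.le]
    simp
  · intro x
    rw [cosSum_div, ← sum_cosSum b x N N le_rfl]
    exact div_nonneg (hpos N x) hN0.le
  · intro k hk x
    rw [← cosSum_sub]
    have hkK : (k : ℝ) ≤ K := by exact_mod_cast hk
    refine (abs_cosSum_le (B := K / N) k (fun l hl => ?_) x).trans ?_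
    · have e : b l - (N - l : ℕ) * b l / N = b l * (l / N) := by
        rw [Nat.cast_sub (by omega)]
        field_simp
        ring
      have hlK : (l : ℝ) ≤ K := by exact_mod_cast hl.trans hk
      rw [e, abs_mul, abs_of_nonneg (by positivity : (0 : ℝ) ≤ l / N)]
      refine (mul_le_of_le_one_left (by positivity) (hb l)).trans ?_
      gcongr
    · rw [div_mul_eq_mul_div, div_le_one hN0, hN]
      push_cast
      have := (K : ℕ).cast_nonneg (α := ℝ)
      have := (L : ℕ).cast_nonneg (α := ℝ)
      nlinarith

theorem exists_measure_le {α : Type*} [MeasurableSpace α] (μ : Measure α) [IsFiniteMeasure μ]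
    {p : ℕ → α → Prop} (hmeas : ∀ K, MeasurableSet {x | p K x})
    (hmono : ∀ x K K', K ≤ K' → p K x → p K' x) (h : ∀ᵐ x ∂μ, ∃ K, p K x)
    {δ : ENNReal} (hδ : 0 < δ) : ∃ K, μ {x | ¬ p K x} ≤ δ := by
  have ht := tendsto_measure_iInter_atTop (μ := μ) (s := fun K => {x | ¬ p K x})
    (fun K => (hmeas K).compl.nullMeasurableSet)
    (fun K K' hK x hx h => hx (hmono x K K' hK h)) ⟨0, measure_ne_top _ _⟩
  have h0 : μ (⋂ K, {x | ¬ p K x}) = 0 := by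
    rw [← compl_mem_ae_iff]
    filter_upwards [h] with x hx
    simpa using hx
  rw [h0] at ht
  exact (ht.eventually (ge_mem_nhds hδ)).exists

/-- Nonnegative even trigonometric polynomials of mean one with large positive and large negative
partial sums outside a small set. -/
theorem exists_trigPoly (M : ℝ) {δ : ENNReal} (hδ : 0 < δ) (L : ℕ) :
    ∃ N ≥ L, ∃ c : ℕ → ℝ, c 0 = 1 ∧ (∀ l, |c l| ≤ 1) ∧ (∀ l, N < l → c l = 0) ∧
      (∀ x, 0 ≤ cosSum c N x) ∧
      volume.restrict (Set.Ioo 0 Real.pi)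
        {x | ¬ ((∃ k ≤ N, M < cosSum c k x) ∧ ∃ k ≤ N, cosSum c k x < -M)} ≤ δ := by
  -- The extra unit pays for the passage to the Fejér mean.
  obtain ⟨n, a, hn, hae⟩ := exists_pointMass (M + 1)
  set b := pointMassCoeff n a with hbdef
  have hmeas1 : ∀ k, MeasurableSet {x | M + 1 < cosSum b k x} := fun k =>
    measurableSet_lt measurable_const (continuous_cosSum b k).measurable
  have hmeas2 : ∀ k, MeasurableSet {x | cosSum b k x < -(M + 1)} := fun k =>
    measurableSet_lt (continuous_cosSum b k).measurable measurable_const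
  obtain ⟨K, hK⟩ := exists_measure_le (volume.restrict (Set.Ioo 0 Real.pi))
    (p := fun K x => (∃ k ≤ K, M + 1 < cosSum b k x) ∧ ∃ k ≤ K, cosSum b k x < -(M + 1))
    (fun K => by
      have : {x | (∃ k ≤ K, M + 1 < cosSum b k x) ∧ ∃ k ≤ K, cosSum b k x < -(M + 1)} =
          (⋃ k ≤ K, {x | M + 1 < cosSum b k x}) ∩ ⋃ k ≤ K, {x | cosSum b k x < -(M + 1)} := by
        ext x
        simp
      rw [this]
      exact (MeasurableSet.iUnion fun k => MeasurableSet.iUnion fun _ => hmeas1 k).inter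
        (MeasurableSet.iUnion fun k => MeasurableSet.iUnion fun _ => hmeas2 k))
    (by
      rintro x K K' hKK ⟨⟨k, hk, h1⟩, l, hl, h2⟩
      exact ⟨⟨k, hk.trans hKK, h1⟩, l, hl.trans hKK, h2⟩)
    (by
      filter_upwards [hae] with x hx
      obtain ⟨⟨k, hk⟩, l, hl⟩ := hx
      exact ⟨max k l, ⟨k, le_max_left _ _, hk⟩, l, le_max_right _ _, hl⟩) hδ
  obtain ⟨N, hNL, c, hc0, hc1, hcN, hcpos, hKN, hclose⟩ := exists_fejer_mean (b := b)
    (by simp [hbdef, pointMassCoeff, hn.ne']) (abs_pointMassCoeff_le n a)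
    (fun m x => by
      simp only [hbdef, cosSum_pointMassCoeff]
      rw [← Finset.sum_div, Finset.sum_comm]
      refine div_nonneg (Finset.sum_nonneg fun j _ => ?_) (by positivity)
      rw [Finset.sum_add_distrib]
      exact add_nonneg (sum_dirichletKernel_nonneg _ _) (sum_dirichletKernel_nonneg _ _)) K L
  refine ⟨N, hNL, c, hc0, hc1, hcN, hcpos, (measure_mono ?_).trans hK⟩
  intro x hx hgood
  obtain ⟨⟨k, hk, h1⟩, l, hl, h2⟩ := hgood
  have hk' := abs_le.1 (hclose k hk x)
  have hl' := abs_le.1 (hclose l hl x)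
  exact hx ⟨⟨k, hk.trans hKN, by linarith⟩, l, hl.trans hKN, by linarith⟩

/-! ### Fourier coefficients of `L¹`-convergent series of cosine sums -/

theorem sum_mul_exp_eq_cosSum (c : ℕ → ℝ) (k : ℕ) (x : ℝ) :
    ∑ l ∈ Finset.Icc (-(k : ℤ)) k, (c l.natAbs : ℂ) * Complex.exp (Complex.I * l * x) =
      cosSum c k x := by
  induction k with
  | zero => simp [cosSum_zero]
  | succ k ih =>
    have h1 : ((k : ℤ) + 1).natAbs = k + 1 := by omega
    have h2 : (-((k : ℤ) + 1)).natAbs = k + 1 := by omega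
    rw [Nat.cast_add, Nat.cast_one, Finset.sum_Icc_succ_eq_add_endpoints, h1, h2, ih, cosSum_succ]
    push_cast
    rw [mul_assoc 2, mul_left_comm, Complex.two_cos]
    ring_nf

theorem integral_exp_int (n : ℤ) :
    ∫ θ in (-Real.pi)..Real.pi, Complex.exp (Complex.I * n * θ) =
      if n = 0 then 2 * (Real.pi : ℂ) else 0 := by
  split_ifs with h
  · simp [h]; ring
  · rw [integral_exp_mul_complex (mul_ne_zero Complex.I_ne_zero (Int.cast_ne_zero.2 h))]
    have : Complex.exp (Complex.I * n * Real.pi) =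
        Complex.exp (Complex.I * n * ((-Real.pi : ℝ) : ℂ)) := by
      rw [Complex.exp_eq_exp_iff_exists_int]
      exact ⟨n, by push_cast; ring⟩
    rw [this, sub_self, zero_div]

theorem integral_cosSum_mul_exp {c : ℕ → ℝ} {N : ℕ} (hc : ∀ l, N < l → c l = 0) (l : ℤ) :
    ∫ θ in (-Real.pi)..Real.pi, (cosSum c N θ : ℂ) * Complex.exp (-(Complex.I * l * θ)) =
      2 * Real.pi * c l.natAbs := by
  have h : ∀ θ : ℝ, (cosSum c N θ : ℂ) * Complex.exp (-(Complex.I * l * θ)) =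
      ∑ m ∈ Finset.Icc (-(N : ℤ)) N,
        (c m.natAbs : ℂ) * Complex.exp (Complex.I * (m - l : ℤ) * θ) := by
    intro θ
    rw [← sum_mul_exp_eq_cosSum, Finset.sum_mul]
    refine Finset.sum_congr rfl fun m _ => ?_
    rw [mul_assoc, ← Complex.exp_add]
    push_cast
    ring_nf
  simp only [h]
  rw [intervalIntegral.integral_finsetSum]
  · simp only [intervalIntegral.integral_const_mul, integral_exp_int, sub_eq_zero, mul_ite, mul_zero]
    rw [Finset.sum_ite_eq']
    split_ifs with hl
    · ring
    · rw [hc _ (by rw [Finset.mem_Icc] at hl; omega)]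
      simp
  · intro m _
    exact Continuous.intervalIntegrable (by fun_prop) _ _

theorem integral_cosSum {c : ℕ → ℝ} {N : ℕ} (hc : ∀ l, N < l → c l = 0) :
    ∫ θ in (-Real.pi)..Real.pi, cosSum c N θ = 2 * Real.pi * c 0 := by
  have h := integral_cosSum_mul_exp hc 0
  simp only [Int.cast_zero, mul_zero, zero_mul, neg_zero, Complex.exp_zero, mul_one,
    Int.natAbs_zero] at h
  rw [intervalIntegral.integral_ofReal] at h
  exact_mod_cast h

section Series

variable {γ : ℕ → ℝ} {c : ℕ → ℕ → ℝ} {N : ℕ → ℕ}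

theorem hasSum_cosSum (hγ : ∀ J, 0 ≤ γ J) (hγs : Summable γ) (hc : ∀ J l, |c J l| ≤ 1)
    (k : ℕ) (x : ℝ) :
    HasSum (fun J => γ J * cosSum (c J) k x) (cosSum (fun l => ∑' J, γ J * c J l) k x) := by
  have hs : ∀ l, HasSum (fun J => γ J * c J l) (∑' J, γ J * c J l) := fun l =>
    (hγs.of_norm_bounded fun J => by
      rw [Real.norm_eq_abs, abs_mul, abs_of_nonneg (hγ J)]
      exact mul_le_of_le_one_right (hγ J) (hc J l)).hasSum
  refine (hasSum_sum (s := Finset.Icc (-(k : ℤ)) k) fun l _ =>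
    (hs l.natAbs).mul_right (Real.cos (l * x))).congr_fun ?_
  intro J
  simp only [cosSum, Finset.mul_sum, mul_assoc]

theorem integral_norm_term (hγ : ∀ J, 0 ≤ γ J) (hc0 : ∀ J, c J 0 = 1)
    (hcN : ∀ J l, N J < l → c J l = 0) (hpos : ∀ J x, 0 ≤ cosSum (c J) (N J) x) (J : ℕ) :
    ∫ θ in Set.Ioc (-Real.pi) Real.pi, ‖γ J * cosSum (c J) (N J) θ‖ = γ J * (2 * Real.pi) := by
  have h : ∀ θ, ‖γ J * cosSum (c J) (N J) θ‖ = γ J * cosSum (c J) (N J) θ := fun θ =>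
    Real.norm_of_nonneg (mul_nonneg (hγ J) (hpos J θ))
  simp only [h]
  rw [integral_const_mul, ← intervalIntegral.integral_of_le (by linarith [Real.pi_pos]),
    integral_cosSum (hcN J), hc0, mul_one]

/-- A nonnegative block of mean one has `L¹` norm `2π`, so the norms of the terms are summable
however large the blocks are pointwise. -/
theorem integrableOn_series (hγ : ∀ J, 0 ≤ γ J) (hγs : Summable γ) (hc0 : ∀ J, c J 0 = 1)
    (hcN : ∀ J l, N J < l → c J l = 0) (hpos : ∀ J x, 0 ≤ cosSum (c J) (N J) x) :
    IntegrableOn (fun x => ∑' J, γ J * cosSum (c J) (N J) x) (Set.Icc (-Real.pi) Real.pi) := by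
  have hcont : ∀ J, Continuous fun x => γ J * cosSum (c J) (N J) x := fun J =>
    continuous_const.mul (continuous_cosSum _ _)
  rw [integrableOn_Icc_iff_integrableOn_Ioc]
  refine ⟨(Measurable.tsum fun J => (hcont J).measurable).aestronglyMeasurable, ?_⟩
  refine lt_of_le_of_lt (lintegral_mono fun x => enorm_tsum_le_tsum_enorm) ?_
  rw [lintegral_tsum fun J => (hcont J).measurable.enorm.aemeasurable]
  have : ∀ J, ∫⁻ x in Set.Ioc (-Real.pi) Real.pi, ‖γ J * cosSum (c J) (N J) x‖ₑ =
      ENNReal.ofReal (γ J * (2 * Real.pi)) := by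
    intro J
    rw [← integral_norm_term hγ hc0 hcN hpos J, ofReal_integral_norm_eq_lintegral_enorm]
    exact (hcont J).integrableOn_Ioc
  simp only [this]
  rw [← ENNReal.ofReal_tsum_of_nonneg (fun J => mul_nonneg (hγ J) Real.two_pi_pos.le)
    (hγs.mul_right _)]
  exact ENNReal.ofReal_lt_top

theorem fourierHat_series (hγ : ∀ J, 0 ≤ γ J) (hγs : Summable γ) (hc0 : ∀ J, c J 0 = 1)
    (hcN : ∀ J l, N J < l → c J l = 0) (hpos : ∀ J x, 0 ≤ cosSum (c J) (N J) x) (l : ℤ) :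
    fourierHat (fun x => ((∑' J, γ J * cosSum (c J) (N J) x : ℝ) : ℂ)) l =
      ((∑' J, γ J * c J l.natAbs : ℝ) : ℂ) := by
  have hle : -Real.pi ≤ Real.pi := by linarith [Real.pi_pos]
  have hsum := integral_tsum_of_summable_integral_norm
    (μ := volume.restrict (Set.Ioc (-Real.pi) Real.pi))
    (F := fun J (θ : ℝ) =>
      ((γ J * cosSum (c J) (N J) θ : ℝ) : ℂ) * Complex.exp (-(Complex.I * l * θ)))
    (fun J => by
      have hcont := continuous_cosSum (c J) (N J)
      exact Continuous.integrableOn_Ioc (by fun_prop))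
    (by
      have h : ∀ J (θ : ℝ), ‖((γ J * cosSum (c J) (N J) θ : ℝ) : ℂ) *
          Complex.exp (-(Complex.I * l * θ))‖ = ‖γ J * cosSum (c J) (N J) θ‖ := by
        intro J θ
        have e : -(Complex.I * l * θ) = ((-(l * θ) : ℝ) : ℂ) * Complex.I := by push_cast; ring
        rw [norm_mul, e, Complex.norm_exp_ofReal_mul_I, mul_one, Complex.norm_real]
      simp only [h, integral_norm_term hγ hc0 hcN hpos]
      exact hγs.mul_right _)
  rw [fourierHat_eq, intervalIntegral.integral_of_le hle]
  simp only [Complex.ofReal_tsum, ← tsum_mul_right]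
  rw [← hsum, ← tsum_mul_left]
  refine tsum_congr fun J => ?_
  simp only [Complex.ofReal_mul, mul_assoc]
  rw [integral_const_mul, ← intervalIntegral.integral_of_le hle]
  have := integral_cosSum_mul_exp (hcN J) l
  simp only [mul_assoc] at this
  rw [this]
  have hpi : (Real.pi : ℂ) ≠ 0 := by exact_mod_cast Real.pi_ne_zero
  field_simp

end Series

/-! ### Limits superior and almost everywhere properties -/

theorem limsup_coe_eq_top {u : ℕ → ℝ} (h : ∀ B, ∃ n, B < u n) :
    limsup (fun n => (u n : EReal)) atTop = ⊤ := by
  -- A sequence eventually below `B` is bounded above on all of `ℕ`, so one large value for every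
  -- bound already gives infinitely many.
  have hf : ∀ B : ℝ, ∃ᶠ n in atTop, B ≤ u n := by
    intro B hB
    have hb : IsBoundedUnder (· ≤ ·) atTop u :=
      isBoundedUnder_of_eventually_le (a := B) (hB.mono fun n hn => (not_le.1 hn).le)
    obtain ⟨C, hC⟩ := hb.bddAbove_range
    obtain ⟨n, hn⟩ := h C
    exact absurd (hC ⟨n, rfl⟩) (not_le.2 hn)
  rw [EReal.eq_top_iff_forall_lt]
  intro y
  refine lt_of_lt_of_le (EReal.coe_lt_coe_iff.2 (lt_add_one y))
    (le_limsup_of_frequently_le' ((hf (y + 1)).mono fun n hn => EReal.coe_le_coe_iff.2 hn))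

theorem liminf_coe_eq_bot {u : ℕ → ℝ} (h : ∀ B, ∃ n, u n < B) :
    liminf (fun n => (u n : EReal)) atTop = ⊥ := by
  have h1 := limsup_coe_eq_top (u := fun n => -u n) fun B => by
    obtain ⟨n, hn⟩ := h (-B)
    exact ⟨n, by linarith⟩
  have h2 : (fun n => ((-u n : ℝ) : EReal)) = -fun n => (u n : EReal) := by
    ext n
    simp
  rw [h2, EReal.limsup_neg] at h1
  exact EReal.neg_eq_top_iff.1 h1

/-- An even `2π`-periodic property holding almost everywhere on `(0, π)` holds almost
everywhere. -/
theorem ae_of_ae_Ioo_of_even_of_periodic {P : ℝ → Prop} (heven : ∀ x, P (-x) → P x)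
    (hper : ∀ x (m : ℤ), P (x + m * (2 * Real.pi)) → P x)
    (h : ∀ᵐ x ∂(volume.restrict (Set.Ioo 0 Real.pi)), P x) : ∀ᵐ x : ℝ, P x := by
  rw [ae_restrict_iff' measurableSet_Ioo] at h
  have h1 : ∀ᵐ x : ℝ, ∀ m : ℤ, x + m * (2 * Real.pi) ∈ Set.Ioo 0 Real.pi →
      P (x + m * (2 * Real.pi)) := ae_all_iff.2 fun m =>
    (measurePreserving_add_right volume ((m : ℝ) * (2 * Real.pi))).quasiMeasurePreserving.ae h
  have hneg := (Measure.measurePreserving_neg (volume : Measure ℝ)).quasiMeasurePreserving.ae h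
  have h2 : ∀ᵐ x : ℝ, ∀ m : ℤ, -(x + m * (2 * Real.pi)) ∈ Set.Ioo 0 Real.pi →
      P (-(x + m * (2 * Real.pi))) := ae_all_iff.2 fun m =>
    (measurePreserving_add_right volume ((m : ℝ) * (2 * Real.pi))).quasiMeasurePreserving.ae hneg
  have h3 : (Set.range fun m : ℤ => (m : ℝ) * Real.pi).Countable := Set.countable_range _
  filter_upwards [h1, h2, h3.ae_notMem volume] with x hx1 hx2 hx3
  obtain ⟨m, ⟨hl, hr⟩, -⟩ := existsUnique_add_zsmul_mem_Ioc Real.two_pi_pos x (-Real.pi)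
  rw [zsmul_eq_mul] at hl hr
  refine hper x m ?_
  rcases lt_trichotomy (x + m * (2 * Real.pi)) 0 with h0 | h0 | h0
  · exact heven _ (hx2 m ⟨by linarith, by linarith⟩)
  · exact absurd ⟨-2 * m, by push_cast; linarith⟩ hx3
  · refine hx1 m ⟨h0, lt_of_le_of_ne (by linarith) fun he => hx3 ⟨1 - 2 * m, ?_⟩⟩
    push_cast
    linarith

/-! ### The divergent series -/

/-- Up to the frequency `N J`, the partial sums of the series differ boundedly from those of its
`J`-th block. -/
theorem abs_cosSum_series_sub_le {c : ℕ → ℕ → ℝ} {L N : ℕ → ℕ} (hL : ∀ J, L (J + 1) = N J)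
    (hLN : ∀ J, L J ≤ N J) (hc : ∀ J l, |c J l| ≤ 1) (hcN : ∀ J l, N J < l → c J l = 0)
    {S : ℝ} {J k : ℕ} (hk : k ≤ N J) {x : ℝ}
    (hS : HasSum (fun i => (1 / 2) ^ i / (2 * (L i : ℝ) + 1) * cosSum (c i) k x) S) :
    |S - (1 / 2) ^ J / (2 * (L J : ℝ) + 1) * cosSum (c J) k x| ≤ 2 * (2 * L J + 1) := by
  have hmono : Monotone L := monotone_nat_of_le_succ fun i => by rw [hL]; exact hLN i
  have h1 := (hS.update J 0).norm_le_of_bounded (hasSum_geometric_two.mul_right (2 * (L J : ℝ) + 1))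
    (fun i => by
      rcases eq_or_ne i J with rfl | hi
      · rw [Function.update_self, norm_zero]
        positivity
      · rw [Function.update_of_ne hi, Real.norm_eq_abs, abs_mul, abs_of_nonneg (by positivity),
          div_mul_eq_mul_div, mul_div_assoc]
        gcongr
        rw [div_le_iff₀ (by positivity)]
        have hLi : (0 : ℝ) ≤ L i := by positivity
        have hLJ : (0 : ℝ) ≤ L J := by positivity
        rcases lt_or_gt_of_ne hi with h | h
        · have hN : (N i : ℝ) ≤ L J := by
            rw [← hL i]
            exact_mod_cast hmono h
          have hb : |cosSum (c i) k x| ≤ 2 * (N i : ℝ) + 1 := by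
            rcases le_total k (N i) with hki | hki
            · have := abs_cosSum_le k (fun l _ => hc i l) x
              have : (k : ℝ) ≤ N i := by exact_mod_cast hki
              linarith
            · rw [cosSum_eq_of_le (hcN i) hki]
              simpa using abs_cosSum_le (N i) (fun l _ => hc i l) x
          nlinarith
        -- For later blocks `k ≤ N J ≤ L i`, so the denominator `2 * L i + 1` of the weight absorbs
        -- the `2k + 1` terms.
        · have hk' : (k : ℝ) ≤ L i := by
            have := hmono h
            rw [Nat.succ_eq_add_one, hL] at this
            exact_mod_cast hk.trans this
          have := abs_cosSum_le k (fun l _ => hc i l) x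
          nlinarith)
  rw [Real.norm_eq_abs] at h1
  convert h1 using 2
  ring

/-- Each block is chosen once the previous degree is known. Its weighted partial sums must beat the
interference `2 * (2 * L J + 1)` of the other blocks by `J`; the exceptional sets have summable
measures, so Borel–Cantelli applies. -/
theorem exists_blocks : ∃ (L N : ℕ → ℕ) (c : ℕ → ℕ → ℝ), (∀ J, L (J + 1) = N J) ∧
    (∀ J, L J ≤ N J) ∧ (∀ J, c J 0 = 1) ∧ (∀ J l, |c J l| ≤ 1) ∧
    (∀ J l, N J < l → c J l = 0) ∧ (∀ J x, 0 ≤ cosSum (c J) (N J) x) ∧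
    ∀ᵐ x ∂(volume.restrict (Set.Ioo 0 Real.pi)), ∀ᶠ J in atTop,
      (∃ k ≤ N J, 2 * (2 * (L J : ℝ) + 1) + J <
        (1 / 2) ^ J / (2 * (L J : ℝ) + 1) * cosSum (c J) k x) ∧
      ∃ k ≤ N J, (1 / 2) ^ J / (2 * (L J : ℝ) + 1) * cosSum (c J) k x <
        -(2 * (2 * (L J : ℝ) + 1) + J) := by
  let M : ℕ → ℕ → ℝ := fun J L =>
    (2 * (2 * (L : ℝ) + 1) + J) / ((1 / 2) ^ J / (2 * (L : ℝ) + 1))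
  choose N hN c hc0 hc1 hcN hpos hmeas using fun J L : ℕ =>
    exists_trigPoly (M J L) (δ := (1 / 2) ^ J) (by simp [ENNReal.pow_pos]) L
  obtain ⟨L, hL⟩ : ∃ L : ℕ → ℕ, ∀ J, L (J + 1) = N J (L J) :=
    ⟨fun J => Nat.rec 0 N J, fun J => rfl⟩
  refine ⟨L, fun J => N J (L J), fun J => c J (L J), hL, fun J => hN J (L J),
    fun J => hc0 _ _, fun J => hc1 _ _, fun J => hcN _ _, fun J => hpos _ _, ?_⟩
  have hfin : ∑' J, volume.restrict (Set.Ioo 0 Real.pi)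
      {x | ¬ ((∃ k ≤ N J (L J), M J (L J) < cosSum (c J (L J)) k x) ∧
        ∃ k ≤ N J (L J), cosSum (c J (L J)) k x < -M J (L J))} ≠ ⊤ := by
    refine ne_top_of_le_ne_top ?_ (ENNReal.tsum_le_tsum fun J => hmeas J (L J))
    rw [ENNReal.tsum_geometric]
    simp
  filter_upwards [ae_eventually_notMem hfin] with x hx
  filter_upwards [hx] with J hJ
  have hγ : (0 : ℝ) < (1 / 2) ^ J / (2 * (L J : ℝ) + 1) := by positivity
  obtain ⟨⟨k, hk, h1⟩, l, hl, h2⟩ := not_not.1 hJ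
  refine ⟨⟨k, hk, ?_⟩, l, hl, ?_⟩
  · rwa [div_lt_iff₀' hγ] at h1
  · rwa [← neg_div, lt_div_iff₀' hγ] at h2

theorem theorem2 :
    ∃ f : ℝ → ℝ,
      Function.Periodic f (2 * Real.pi) ∧
      Function.Even f ∧
      (∀ θ : ℝ, 0 ≤ f θ) ∧
      IntegrableOn f (Set.Icc (-Real.pi) Real.pi) volume ∧
      ∀ᵐ θ : ℝ ∂volume, FourierSeriesDivergesUnboundedlyAt (fun x : ℝ => (f x : ℂ)) θ := by
  obtain ⟨L, N, c, hL, hLN, hc0, hc1, hcN, hpos, hae⟩ := exists_blocks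
  set γ : ℕ → ℝ := fun J => (1 / 2) ^ J / (2 * (L J : ℝ) + 1) with hγdef
  have hγ : ∀ J, 0 ≤ γ J := fun J => by positivity
  have hγs : Summable γ := summable_geometric_two.of_nonneg_of_le hγ fun J =>
    div_le_self (by positivity) (by linarith [(L J).cast_nonneg (α := ℝ)])
  have hS : ∀ n θ, symmPartialFourierSum
      (fun x => ((∑' J, γ J * cosSum (c J) (N J) x : ℝ) : ℂ)) n θ =
        (cosSum (fun l => ∑' J, γ J * c J l) n θ : ℂ) := by
    intro n θ
    simp only [symmPartialFourierSum, fourierHat_series hγ hγs hc0 hcN hpos]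
    exact sum_mul_exp_eq_cosSum (fun l => ∑' J, γ J * c J l) n θ
  -- At points where the series diverges `∑'` is `0`, so periodicity, evenness and nonnegativity
  -- hold at every point.
  refine ⟨fun x => ∑' J, γ J * cosSum (c J) (N J) x, fun x => ?_, fun x => ?_, fun x => ?_,
    integrableOn_series hγ hγs hc0 hcN hpos, ?_⟩
  · refine tsum_congr fun J => ?_
    have := cosSum_add_int_mul_two_pi (c J) (N J) x 1
    rw [Int.cast_one, one_mul] at this
    rw [this]
  · exact tsum_congr fun J => by rw [cosSum_neg]
  · exact tsum_nonneg fun J => mul_nonneg (hγ J) (hpos J x)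
  simp only [FourierSeriesDivergesUnboundedlyAt, hS, Complex.ofReal_im, Complex.ofReal_re]
  refine ae_of_ae_Ioo_of_even_of_periodic (fun x hx => by simpa only [cosSum_neg] using hx)
    (fun x m hx => by simpa only [cosSum_add_int_mul_two_pi] using hx) ?_
  filter_upwards [hae] with x hx
  refine ⟨fun _ => trivial, limsup_coe_eq_top fun B => ?_, liminf_coe_eq_bot fun B => ?_⟩
  · obtain ⟨J, hJ, hB⟩ := (hx.and (tendsto_natCast_atTop_atTop.eventually_ge_atTop B)).exists
    obtain ⟨⟨k, hk, h1⟩, -⟩ := hJ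
    have := abs_le.1 (abs_cosSum_series_sub_le hL hLN hc1 hcN hk (hasSum_cosSum hγ hγs hc1 k x))
    exact ⟨k, by linarith⟩
  · obtain ⟨J, hJ, hB⟩ := (hx.and (tendsto_natCast_atTop_atTop.eventually_ge_atTop (-B))).exists
    obtain ⟨-, k, hk, h1⟩ := hJ
    have := abs_le.1 (abs_cosSum_series_sub_le hL hLN hc1 hcN hk (hasSum_cosSum hγ hγs hc1 k x))
    exact ⟨k, by linarith⟩
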